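/- For $\gamma>0$ consider, on the strip $[-\frac{\pi}{2},\frac{\pi}{2}]\times\mathbb{R}$ (the universal cover of the cylinder $[-\frac{\pi}{2},\frac{\pi}{2}]\times\mathbb{S}^1$), the dynamical system with energy $E=1$, $$\dot z=\cos^2 z,\qquad \dot\Theta = 2\cos\Theta-\gamma\, e^{-|\tan z|}-2E,$$ where $e^{-|\tan z|}$ is understood to be $0$ at $z=\pm\frac{\pi}{2}$. A heteroclinic orbit is an orbit whose $\alpha$-limit is an equilibrium $(-\frac{\pi}{2},\Theta(-\infty))$ on the left boundary and whose $\omega$-limit is an equilibrium $(\frac{\pi}{2},\Theta(\infty))$ on the right boundary; its winding number is $\left\lfloor\frac{\Theta(-\infty)-\Theta(\infty)}{2\pi}\right\rfloor$. Let $$M_{\kappa,\mu}(z)=e^{-z/2}z^{\frac12+\mu}\sum_{n=0}^\infty\frac{(\frac12+\mu-\kappa)_n}{(1+2\mu)_n\,n!}z^n$$ be the Whittaker function, where $(a)_n=a(a+1)\cdots(a+n-1)$. Theorem. There is a strictly increasing sequence $0=\gamma_0<\gamma_1<\gamma_2<\cdots$ such that $\gamma_1,\gamma_3,\gamma_5,\dots$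 are exactly the positive numbers $r$ with $M'_{-i,1/2}(ir)=0$ and $\gamma_2,\gamma_4,\gamma_6,\dots$ are exactly the positive numbers $r$ with $M_{-i,1/2}(ir)=0$, and such that the following holds. If $\gamma\in(\gamma_{k-1},\gamma_k]$ for some integer $k\ge 1$, then the system has a heteroclinic orbit with winding number $k$ and another one with winding number $k+1$, and it has no heteroclinic orbit with winding number larger than $k+1$. -/

import Mathlib

open Filter Topology

noncomputable section

/-- Kummer's confluent hypergeometric function
`M(a, b, z) = ∑ₙ (a)ₙ zⁿ / ((b)ₙ n!)`, where `(a)ₙ` is the rising factorial. -/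
def kummerM (a b z : ℂ) : ℂ :=
  ∑' n : ℕ, (ascPochhammer ℂ n).eval a / ((ascPochhammer ℂ n).eval b * (n.factorial : ℂ)) * z ^ n

/-- The Whittaker function
`M_{κ,μ}(z) = e^{-z/2} z^{1/2+μ} M(1/2 + μ - κ, 1 + 2μ, z)` (principal branch of the power). -/
def whittakerM (κ μ z : ℂ) : ℂ :=
  Complex.exp (-z / 2) * z ^ (1 / 2 + μ) * kummerM (1 / 2 + μ - κ) (1 + 2 * μ) z

/-- The screened potential `exp (-|tan z|)` for `|z| < π/2`, extended continuously by the value `0`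
to the two boundary circles `z = ±π/2`, where `cos z = 0`. -/
def screenedPotential (z : ℝ) : ℝ :=
  if Real.cos z = 0 then 0 else Real.exp (-|Real.tan z|)

/-- The vector field `(ż, Θ̇) = (cos² z, 2 cos Θ - γ exp (-|tan z|) - 2 E)`. -/
def diracField (γ E : ℝ) (x : ℝ × ℝ) : ℝ × ℝ :=
  (Real.cos x.1 ^ 2, 2 * Real.cos x.2 - γ * screenedPotential x.1 - 2 * E)

/-- The closed strip `[-π/2, π/2] × ℝ`, universal cover of the cylinder `[-π/2, π/2] × S¹`. -/
def strip : Set (ℝ × ℝ) :=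
  {x | x.1 ∈ Set.Icc (-(Real.pi / 2)) (Real.pi / 2)}

/-- Equilibrium points of the system on the closed strip. -/
def IsEquilibrium (γ E : ℝ) (x : ℝ × ℝ) : Prop :=
  x ∈ strip ∧ diracField γ E x = 0

/-- `y` parametrizes a heteroclinic orbit (lifted to the strip) that leads from the equilibrium `p`
on the left boundary, its `α`-limit, to the equilibrium `q` on the right boundary, its `ω`-limit. -/
structure IsHeteroclinicOrbit (γ E : ℝ) (y : ℝ → ℝ × ℝ) (p q : ℝ × ℝ) : Prop where
  mem_strip : ∀ τ, y τ ∈ strip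
  solution : ∀ τ, HasDerivAt y (diracField γ E (y τ)) τ
  source_eq : IsEquilibrium γ E p
  target_eq : IsEquilibrium γ E q
  source_left : p.1 = -(Real.pi / 2)
  target_right : q.1 = Real.pi / 2
  alpha_limit : Tendsto y atBot (𝓝 p)
  omega_limit : Tendsto y atTop (𝓝 q)

/-- The winding number `⌊(Θ(-∞) - Θ(∞)) / 2π⌋` of an orbit from `p` to `q`. -/
def windingNumber (p q : ℝ × ℝ) : ℤ :=
  ⌊(p.2 - q.2) / (2 * Real.pi)⌋

end

/-!
For `E = 1` an interior orbit has `tan z = t` up to a translation of time, and the half angle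
`φ = Θ / 2` solves the phase equation `φ' = -2 sin² φ - (γ / 2) e^{-|t|}`. Its solutions decrease, and
they converge to multiples of `π` at both ends, so that the winding number is an integer and counts
the half turns of `φ`. The equation is invariant under `t ↦ -t`, `φ ↦ -φ`, which reduces everything
to the half line `t ≤ 0`.

There the substitution `s = γ eᵗ` removes the parameter: `φ = -A(s)` solves the equation exactly
if `s A' = s / 2 + 2 sin² A`, and this is the Prüfer equation of the Whittaker equation
`b'' = -(1/s + 1/4) b`, with `A` the angle of the vector `(2 b', b)` (`mul_pruferSpeed`). The solution
`b(s) = M_{-i,1/2}(is) / i` gives the angle with `A(0) = 0`. It is real: the energy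
`b² / s + b² / 4 + b'²` decreases, so a solution with `b(0) = b'(0) = 0`, such as the imaginary part
of `b`, vanishes (`IsAxisSolution.eq_zero`). As `A' ≥ 1/2`, the angle increases from `0` to infinity,
and the zeros of `b'` and `b` are the numbers `γ_k` with `A(γ_k) = k π / 2`, for `k` odd and even
respectively.

The solution `φ_L(t) = -A(γ eᵗ)` is the largest one that emanates from `0`
(`IsPhase.apply_zero_le_of_tendsto`), and the solutions that emanate from `0` are those with
`-A(γ) - π < φ(0) ≤ -A(γ)` (`IsPhase.tendsto_zero`, `IsPhase.lt_apply_zero_of_tendsto`). By reflection,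
those that converge to `-w π` as `t → ∞` have `A(γ) - w π ≤ φ(0) < A(γ) - w π + π`. Both conditions can
be met only if `w π < 2 A(γ) + 2 π`, and the symmetric choice `φ(0) = -w π / 2` meets them if
`A(γ) ≤ w π / 2 < A(γ) + π`. For `(k - 1) π / 2 < A(γ) ≤ k π / 2` these are the bound `w ≤ k + 1` and
the orbits with `w = k` and `w = k + 1`.
-/

/-! ### Kummer's function and the Whittaker equation -/

/-- A power series with coefficients bounded by `1 / n!` is entire. The shifted coefficients
`(n + 1) c (n + 1)` of its derivative satisfy the same bound, so the lemma can be iterated. -/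
theorem hasDerivAt_tsum_of_norm_le_inv_factorial {c : ℕ → ℂ}
    (hc : ∀ n, ‖c n‖ ≤ 1 / (n.factorial : ℝ)) (z : ℂ) :
    HasDerivAt (fun w : ℂ => ∑' n, c n * w ^ n) (∑' n : ℕ, ((n : ℂ) + 1) * c (n + 1) * z ^ n) z := by
  set R : ℝ := ‖z‖ + 1 with hR
  have hR0 : 0 ≤ R := by positivity
  have hu : Summable fun n : ℕ => 1 / (n.factorial : ℝ) * (n * R ^ (n - 1)) := by
    rw [← summable_nat_add_iff 1]
    refine (Real.summable_pow_div_factorial R).congr fun n => ?_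
    have h1 : (n.factorial : ℝ) ≠ 0 := by positivity
    have h2 : (n : ℝ) + 1 ≠ 0 := by positivity
    simp only [Nat.factorial_succ, Nat.add_sub_cancel]
    push_cast
    field_simp
  have hg' : ∀ (n : ℕ) (y : ℂ), y ∈ Metric.ball (0 : ℂ) R →
      ‖c n * (n * y ^ (n - 1))‖ ≤ 1 / (n.factorial : ℝ) * (n * R ^ (n - 1)) := by
    intro n y hy
    rw [mem_ball_zero_iff] at hy
    rw [norm_mul, norm_mul, norm_pow, Complex.norm_natCast]
    gcongr
    exact hc n
  have hz : z ∈ Metric.ball (0 : ℂ) R := by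
    rw [mem_ball_zero_iff]; linarith
  have key := hasDerivAt_tsum_of_isPreconnected (g := fun n w => c n * w ^ n) hu
    Metric.isOpen_ball (convex_ball (0 : ℂ) R).isPreconnected
    (fun n y _ => (hasDerivAt_pow n y).const_mul (c n)) hg' (y₀ := 0) (by simp; positivity)
    (summable_of_ne_finset_zero (s := {0}) fun n hn => by
      simp at hn; simp [hn]) hz
  convert! key using 1
  rw [(Summable.of_norm_bounded hu fun n => hg' n z hz).tsum_eq_zero_add]
  simp only [Nat.cast_zero, zero_mul, mul_zero, zero_add, Nat.add_sub_cancel]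
  refine tsum_congr fun n => ?_
  push_cast; ring

theorem summable_of_norm_le_inv_factorial {c : ℕ → ℂ}
    (hc : ∀ n, ‖c n‖ ≤ 1 / (n.factorial : ℝ)) (z : ℂ) : Summable fun n => c n * z ^ n := by
  refine Summable.of_norm_bounded (Real.summable_pow_div_factorial ‖z‖) fun n => ?_
  rw [norm_mul, norm_pow]
  calc ‖c n‖ * ‖z‖ ^ n ≤ 1 / (n.factorial : ℝ) * ‖z‖ ^ n := by gcongr; exact hc n
    _ = _ := by ring

theorem norm_succ_mul_le_inv_factorial {c : ℕ → ℂ}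
    (hc : ∀ n, ‖c n‖ ≤ 1 / (n.factorial : ℝ)) (n : ℕ) :
    ‖((n : ℂ) + 1) * c (n + 1)‖ ≤ 1 / (n.factorial : ℝ) := by
  have h1 : ‖(n : ℂ) + 1‖ = n + 1 := by
    rw [← Nat.cast_succ, Complex.norm_natCast]; simp
  rw [norm_mul, h1]
  calc ((n : ℝ) + 1) * ‖c (n + 1)‖ ≤ ((n : ℝ) + 1) * (1 / ((n + 1).factorial : ℝ)) := by
        gcongr; exact hc _
    _ = _ := by
        have h2 : (n.factorial : ℝ) ≠ 0 := by positivity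
        have h3 : (n : ℝ) + 1 ≠ 0 := by positivity
        rw [Nat.factorial_succ]; push_cast; field_simp

/-- The coefficients of the Kummer series `M(1 + i, 2, ·)`. -/
noncomputable def kummerCoeff (n : ℕ) : ℂ :=
  (ascPochhammer ℂ n).eval (1 + Complex.I) / ((ascPochhammer ℂ n).eval 2 * (n.factorial : ℂ))

theorem kummerCoeff_zero : kummerCoeff 0 = 1 := by simp [kummerCoeff]

theorem kummerCoeff_succ (n : ℕ) :
    ((n : ℂ) + 1) * (n + 2) * kummerCoeff (n + 1) = (n + 1 + Complex.I) * kummerCoeff n := by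
  have h2 : ∀ m : ℕ, (ascPochhammer ℂ m).eval (2 : ℂ) ≠ 0 := by
    intro m
    have := ascPochhammer_pos m (2 : ℕ) (by norm_num)
    have h : (((ascPochhammer ℕ m).eval 2 : ℕ) : ℂ) = (ascPochhammer ℂ m).eval (2 : ℂ) := by
      have := ascPochhammer_eval_cast (S := ℂ) m 2
      rwa [Nat.cast_ofNat] at this
    rw [← h]; exact_mod_cast this.ne'
  have h3 : (n.factorial : ℂ) ≠ 0 := by exact_mod_cast n.factorial_ne_zero
  have h4 : (n : ℂ) + 1 ≠ 0 := by exact_mod_cast n.succ_ne_zero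
  have h5 : (n : ℂ) + 2 ≠ 0 := by exact_mod_cast (n + 1).succ_ne_zero
  have h6 : (2 : ℂ) + n ≠ 0 := by rwa [add_comm]
  have h7 := h2 n
  simp only [kummerCoeff, ascPochhammer_succ_eval, Nat.factorial_succ]
  push_cast
  field_simp
  ring

theorem norm_kummerCoeff_le (n : ℕ) : ‖kummerCoeff n‖ ≤ 1 / (n.factorial : ℝ) := by
  induction n with
  | zero => simp [kummerCoeff_zero]
  | succ n ih =>
    have h := congrArg norm (kummerCoeff_succ n)
    have h1 : ‖(n : ℂ) + 1‖ = n + 1 := by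
      rw [← Nat.cast_succ, Complex.norm_natCast]; simp
    have h2 : ‖(n : ℂ) + 2‖ = n + 2 := by
      have : (n : ℂ) + 2 = ((n + 2 : ℕ) : ℂ) := by push_cast; ring
      rw [this, Complex.norm_natCast]; simp
    have h3 : ‖(n : ℂ) + 1 + Complex.I‖ ≤ n + 2 := by
      refine (norm_add_le _ _).trans ?_
      rw [h1, Complex.norm_I]; linarith
    rw [norm_mul, norm_mul, norm_mul, h1, h2] at h
    have h4 : ((n : ℝ) + 2) * ((n + 1) * ‖kummerCoeff (n + 1)‖) ≤ (n + 2) * ‖kummerCoeff n‖ := by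
      calc _ = _ := by ring
        _ = _ := h
        _ ≤ _ := by gcongr
    have h5 : ((n : ℝ) + 1) * ‖kummerCoeff (n + 1)‖ ≤ 1 / (n.factorial : ℝ) :=
      (le_of_mul_le_mul_left h4 (by positivity)).trans ih
    rw [Nat.factorial_succ, Nat.cast_mul, le_div_iff₀ (by positivity)]
    rw [le_div_iff₀ (by positivity)] at h5
    calc _ = _ := by push_cast; ring
      _ ≤ _ := h5

/-- The sum of the power series with the coefficients `(n + 1) kummerCoeff (n + 1)`: the derivative
of `M(1 + i, 2, ·)`. -/
noncomputable def kummerDeriv (z : ℂ) : ℂ :=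
  ∑' n : ℕ, ((n : ℂ) + 1) * kummerCoeff (n + 1) * z ^ n

/-- The termwise second derivative of `M(1 + i, 2, ·)`. -/
noncomputable def kummerDeriv2 (z : ℂ) : ℂ :=
  ∑' n : ℕ, ((n : ℂ) + 1) * ((((n + 1 : ℕ) : ℂ) + 1) * kummerCoeff (n + 1 + 1)) * z ^ n

theorem hasDerivAt_kummerM (z : ℂ) :
    HasDerivAt (kummerM (1 + Complex.I) 2) (kummerDeriv z) z :=
  hasDerivAt_tsum_of_norm_le_inv_factorial norm_kummerCoeff_le z

theorem hasDerivAt_kummerDeriv (z : ℂ) : HasDerivAt kummerDeriv (kummerDeriv2 z) z :=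
  hasDerivAt_tsum_of_norm_le_inv_factorial
    (norm_succ_mul_le_inv_factorial norm_kummerCoeff_le) z

/-- Kummer's differential equation `z F'' + (2 - z) F' = (1 + i) F` for `F = M(1 + i, 2, ·)`. -/
theorem kummer_equation (z : ℂ) :
    z * kummerDeriv2 z + (2 - z) * kummerDeriv z
      = (1 + Complex.I) * kummerM (1 + Complex.I) 2 z := by
  have b0 := norm_kummerCoeff_le
  have b1 := norm_succ_mul_le_inv_factorial b0
  have b2 := norm_succ_mul_le_inv_factorial b1
  have s0 := (summable_of_norm_le_inv_factorial b0 z).hasSum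
  have s1 := (summable_of_norm_le_inv_factorial b1 z).hasSum
  have s2 := (summable_of_norm_le_inv_factorial b2 z).hasSum
  -- multiplication by `z` shifts the coefficients; the shifted series start with a zero term
  have t1 : HasSum (fun n : ℕ => (n : ℂ) * kummerCoeff n * z ^ n) (z * kummerDeriv z) := by
    rw [← hasSum_nat_add_iff' 1]
    simp only [Finset.sum_range_one, Nat.cast_zero, zero_mul, sub_zero]
    convert! s1.mul_left z using 2 with n
    push_cast; ring
  have t2 : HasSum (fun n : ℕ => (n : ℂ) * ((n + 1) * kummerCoeff (n + 1)) * z ^ n)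
      (z * kummerDeriv2 z) := by
    rw [← hasSum_nat_add_iff' 1]
    simp only [Finset.sum_range_one, Nat.cast_zero, zero_mul, sub_zero]
    convert! s2.mul_left z using 2 with n
    push_cast; ring
  have h := (t2.add (s1.mul_left 2)).sub t1
  have h' := s0.mul_left (1 + Complex.I)
  have heq := h.unique (h'.congr_fun ?_)
  · calc _ = z * kummerDeriv2 z + 2 * kummerDeriv z - z * kummerDeriv z := by ring
      _ = _ := heq
  · intro n
    have := kummerCoeff_succ n
    linear_combination z ^ n * this

theorem kummerM_zero : kummerM (1 + Complex.I) 2 0 = 1 := by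
  have : ∀ n : ℕ, n ≠ 0 → kummerCoeff n * (0 : ℂ) ^ n = 0 := fun n hn => by simp [hn]
  calc kummerM (1 + Complex.I) 2 0 = ∑' n : ℕ, kummerCoeff n * (0 : ℂ) ^ n := rfl
    _ = 1 := by rw [tsum_eq_single 0 this]; simp [kummerCoeff_zero]

theorem whittakerM_eq (z : ℂ) :
    whittakerM (-Complex.I) (1 / 2) z
      = Complex.exp (-z / 2) * z * kummerM (1 + Complex.I) 2 z := by
  have h1 : (1 / 2 + 1 / 2 : ℂ) = 1 := by norm_num
  have h2 : (1 + 2 * (1 / 2) : ℂ) = 2 := by norm_num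
  rw [whittakerM, h1, h2, Complex.cpow_one, sub_neg_eq_add]

/-- The derivative of `M_{-i,1/2}`. -/
noncomputable def whittakerDeriv (z : ℂ) : ℂ :=
  Complex.exp (-z / 2)
    * ((1 - z / 2) * kummerM (1 + Complex.I) 2 z + z * kummerDeriv z)

theorem hasDerivAt_exp_neg_half (z : ℂ) :
    HasDerivAt (fun w : ℂ => Complex.exp (-w / 2)) (Complex.exp (-z / 2) * (-1 / 2)) z :=
  (((hasDerivAt_id z).neg).div_const 2).cexp

theorem hasDerivAt_whittakerM (z : ℂ) :
    HasDerivAt (whittakerM (-Complex.I) (1 / 2)) (whittakerDeriv z) z := by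
  rw [funext whittakerM_eq]
  convert! ((hasDerivAt_exp_neg_half z).mul (hasDerivAt_id z)).mul (hasDerivAt_kummerM z) using 1
  simp only [whittakerDeriv, id, Pi.mul_apply]
  ring

/-- Whittaker's equation `M'' = (1/4 + i/z) M`, with the removable singularity at `z = 0`
removed: `M / z = e^{-z/2} F`. -/
theorem hasDerivAt_whittakerDeriv (z : ℂ) :
    HasDerivAt whittakerDeriv
      ((z / 4 + Complex.I) * (Complex.exp (-z / 2) * kummerM (1 + Complex.I) 2 z)) z := by
  have h := (hasDerivAt_exp_neg_half z).mul
    (((((hasDerivAt_id z).div_const 2).const_sub 1).mul (hasDerivAt_kummerM z)).add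
      ((hasDerivAt_id z).mul (hasDerivAt_kummerDeriv z)))
  convert! h using 1
  simp only [id, Pi.mul_apply, Pi.add_apply]
  linear_combination -Complex.exp (-z / 2) * kummer_equation z

/-! ### The Whittaker function on the imaginary axis -/

/-- A real solution of Whittaker's equation `b'' = -(1/s + 1/4) b` that vanishes at `s = 0`, where
the equation is singular. It is encoded by the quotient `β = b / s`, which is continuous at `0`,
and by the derivative `d = b'`. -/
structure IsAxisSolution (β d : ℝ → ℝ) : Prop where
  continuous : Continuous β
  hasDerivAt_mul : ∀ s, HasDerivAt (fun s => s * β s) (d s) s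
  hasDerivAt_deriv : ∀ s, HasDerivAt d (-(1 + s / 4) * β s) s

/-- The energy `b² / s + b² / 4 + b'²` of a solution `b = s β`. -/
noncomputable def axisEnergy (β d : ℝ → ℝ) (s : ℝ) : ℝ := s * β s ^ 2 + (s * β s) ^ 2 / 4 + d s ^ 2

namespace IsAxisSolution

variable {β d : ℝ → ℝ}

theorem continuous_deriv (h : IsAxisSolution β d) : Continuous d :=
  continuous_iff_continuousAt.2 fun s => (h.hasDerivAt_deriv s).continuousAt

theorem continuous_energy (h : IsAxisSolution β d) : Continuous (axisEnergy β d) := by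
  have h1 := h.continuous
  have h2 := h.continuous_deriv
  unfold axisEnergy
  fun_prop

theorem hasDerivAt_energy (h : IsAxisSolution β d) {s : ℝ} (hs : 0 < s) :
    HasDerivAt (axisEnergy β d) (-β s ^ 2) s := by
  have hb := h.hasDerivAt_mul s
  have hd := h.hasDerivAt_deriv s
  have h1 := (((hb.pow 2).div (hasDerivAt_id s) hs.ne').add ((hb.pow 2).div_const 4)).add (hd.pow 2)
  have heq : axisEnergy β d =ᶠ[𝓝 s] fun s => (s * β s) ^ 2 / s + (s * β s) ^ 2 / 4 + d s ^ 2 := by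
    filter_upwards [lt_mem_nhds hs] with x hx
    unfold axisEnergy
    field_simp
  refine HasDerivAt.congr_of_eventuallyEq ?_ heq
  convert! h1 using 1
  simp only [id, Pi.pow_apply]
  field_simp
  ring

theorem energy_nonneg {s : ℝ} (hs : 0 ≤ s) : 0 ≤ axisEnergy β d s := by
  unfold axisEnergy; positivity

theorem antitoneOn_energy (h : IsAxisSolution β d) : AntitoneOn (axisEnergy β d) (Set.Ici 0) := by
  refine antitoneOn_of_hasDerivWithinAt_nonpos (convex_Ici 0) h.continuous_energy.continuousOn
    (f' := fun s => -β s ^ 2) ?_ ?_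
  · intro s hs
    rw [interior_Ici] at hs
    exact (h.hasDerivAt_energy hs).hasDerivWithinAt
  · intro s _
    nlinarith [sq_nonneg (β s)]

theorem monotoneOn_mul_energy (h : IsAxisSolution β d) :
    MonotoneOn (fun s => s * axisEnergy β d s) (Set.Ici 0) := by
  refine monotoneOn_of_hasDerivWithinAt_nonneg (convex_Ici 0)
    (continuous_id.mul h.continuous_energy).continuousOn
    (f' := fun s => (s * β s) ^ 2 / 4 + d s ^ 2) ?_ ?_
  · intro s hs
    rw [interior_Ici] at hs
    have := (hasDerivAt_id s).mul (h.hasDerivAt_energy hs)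
    convert! this.hasDerivWithinAt using 1
    simp only [id, axisEnergy]
    ring
  · intro s _
    positivity

/-- Uniqueness at the singular point: since the energy decreases, a solution with `b'(0) = 0`
vanishes. -/
theorem eq_zero (h : IsAxisSolution β d) (h0 : d 0 = 0) {s : ℝ} (hs : 0 < s) :
    β s = 0 ∧ d s = 0 := by
  have h1 := h.antitoneOn_energy (Set.mem_Ici.2 le_rfl) hs.le hs.le
  simp only [axisEnergy, h0] at h1
  have h2 : 0 ≤ (s * β s) ^ 2 := sq_nonneg _
  have h3 : 0 ≤ s * β s ^ 2 := by positivity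
  have h4 : 0 ≤ d s ^ 2 := sq_nonneg _
  have h5 : s * β s ^ 2 = 0 := by nlinarith
  have h6 : d s ^ 2 = 0 := by nlinarith
  exact ⟨by simpa [hs.ne'] using h5, by simpa using h6⟩

/-- A nontrivial solution has no double zero on `[0, ∞)`. -/
theorem normSq_pos (h : IsAxisSolution β d) (h0 : d 0 ≠ 0) {s : ℝ} (hs : 0 ≤ s) :
    0 < (s * β s) ^ 2 + 4 * d s ^ 2 := by
  by_contra hneg
  have h1 : (s * β s) ^ 2 = 0 := by nlinarith [sq_nonneg (s * β s), sq_nonneg (d s)]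
  have h2 : d s ^ 2 = 0 := by nlinarith [sq_nonneg (s * β s), sq_nonneg (d s)]
  have hs' : 0 < s := by
    rcases hs.eq_or_lt with rfl | hs'
    · exact absurd (by simpa using h2) h0
    · exact hs'
  have h3 : s * axisEnergy β d s = 0 := by
    unfold axisEnergy; linear_combination (1 + s / 4) * h1 + s * h2
  -- `s * energy` is monotone, hence the energy vanishes on `(0, s]` and, by continuity, at `0`
  have h4 : ∀ t ∈ Set.Ioo 0 s, axisEnergy β d t = 0 := by
    intro t ht
    have h5 := h.monotoneOn_mul_energy (Set.mem_Ici.2 ht.1.le) hs ht.2.le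
    simp only [h3] at h5
    have h6 := energy_nonneg (β := β) (d := d) ht.1.le
    nlinarith [ht.1]
  have h7 : axisEnergy β d 0 = 0 := by
    refine tendsto_nhds_unique ((h.continuous_energy.tendsto 0).mono_left
      (nhdsWithin_le_nhds (s := Set.Ioi 0))) (tendsto_const_nhds.congr' ?_)
    filter_upwards [Ioo_mem_nhdsGT hs'] with t ht
    exact (h4 t ht).symm
  simp [axisEnergy] at h7
  exact h0 h7

end IsAxisSolution

/-- The function `N(s) = M_{-i,1/2}(is) / (is)`, as the entire function `e^{-is/2} M(1 + i, 2, is)`. -/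
noncomputable def axisQuotient (s : ℝ) : ℂ :=
  Complex.exp (-(Complex.I * s) / 2) * kummerM (1 + Complex.I) 2 (Complex.I * s)

/-- The function `s ↦ M'_{-i,1/2}(is)`. -/
noncomputable def axisDeriv (s : ℝ) : ℂ := whittakerDeriv (Complex.I * s)

theorem hasDerivAt_I_mul (s : ℝ) : HasDerivAt (fun s : ℝ => Complex.I * (s : ℂ)) Complex.I s := by
  simpa using (Complex.ofRealCLM.hasDerivAt (x := s)).const_mul Complex.I

theorem whittakerM_axis (s : ℝ) :
    whittakerM (-Complex.I) (1 / 2) (Complex.I * s) = Complex.I * (s * axisQuotient s) := by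
  rw [whittakerM_eq, axisQuotient]; ring

theorem hasDerivAt_mul_axisQuotient (s : ℝ) :
    HasDerivAt (fun s : ℝ => (s : ℂ) * axisQuotient s) (axisDeriv s) s := by
  have h := ((hasDerivAt_whittakerM (Complex.I * s)).comp s (hasDerivAt_I_mul s)).const_mul
    (-Complex.I)
  convert! h using 1
  · funext x
    simp only [Function.comp, whittakerM_axis]
    linear_combination ((x : ℂ) * axisQuotient x) * Complex.I_mul_I
  · simp only [axisDeriv]
    linear_combination whittakerDeriv (Complex.I * s) * Complex.I_mul_I

theorem hasDerivAt_axisDeriv (s : ℝ) :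
    HasDerivAt axisDeriv (-(1 + (s : ℂ) / 4) * axisQuotient s) s := by
  have h := (hasDerivAt_whittakerDeriv (Complex.I * s)).comp s (hasDerivAt_I_mul s)
  convert! h using 1
  simp only [axisQuotient]
  linear_combination (-(1 + (s : ℂ) / 4) * (Complex.exp (-(Complex.I * s) / 2)
    * kummerM (1 + Complex.I) 2 (Complex.I * s))) * Complex.I_mul_I

theorem continuous_axisQuotient : Continuous axisQuotient := by
  have h1 : Continuous (kummerM (1 + Complex.I) 2) :=
    continuous_iff_continuousAt.2 fun z => (hasDerivAt_kummerM z).continuousAt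
  unfold axisQuotient
  fun_prop

theorem HasDerivAt.complex_re {f : ℝ → ℂ} {f' : ℂ} {s : ℝ} (h : HasDerivAt f f' s) :
    HasDerivAt (fun s => (f s).re) f'.re s :=
  Complex.reCLM.hasFDerivAt.comp_hasDerivAt s h

theorem HasDerivAt.complex_im {f : ℝ → ℂ} {f' : ℂ} {s : ℝ} (h : HasDerivAt f f' s) :
    HasDerivAt (fun s => (f s).im) f'.im s :=
  Complex.imCLM.hasFDerivAt.comp_hasDerivAt s h

theorem isAxisSolution_re :
    IsAxisSolution (fun s => (axisQuotient s).re) (fun s => (axisDeriv s).re) where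
  continuous := Complex.continuous_re.comp continuous_axisQuotient
  hasDerivAt_mul s := by
    convert! (hasDerivAt_mul_axisQuotient s).complex_re using 1
    funext x; simp
  hasDerivAt_deriv s := by
    convert! (hasDerivAt_axisDeriv s).complex_re using 1
    have : -(1 + (s : ℂ) / 4) = ((-(1 + s / 4) : ℝ) : ℂ) := by push_cast; ring
    rw [this, Complex.re_ofReal_mul]

theorem isAxisSolution_im :
    IsAxisSolution (fun s => (axisQuotient s).im) (fun s => (axisDeriv s).im) where
  continuous := Complex.continuous_im.comp continuous_axisQuotient
  hasDerivAt_mul s := by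
    convert! (hasDerivAt_mul_axisQuotient s).complex_im using 1
    funext x; simp
  hasDerivAt_deriv s := by
    convert! (hasDerivAt_axisDeriv s).complex_im using 1
    have : -(1 + (s : ℂ) / 4) = ((-(1 + s / 4) : ℝ) : ℂ) := by push_cast; ring
    rw [this, Complex.im_ofReal_mul]

theorem axisDeriv_zero : axisDeriv 0 = 1 := by
  simp [axisDeriv, whittakerDeriv, kummerM_zero]

theorem axis_im_eq_zero {r : ℝ} (hr : 0 < r) :
    (axisQuotient r).im = 0 ∧ (axisDeriv r).im = 0 :=
  isAxisSolution_im.eq_zero (by simp [axisDeriv_zero]) hr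

/-- The real function `b(s) = M_{-i,1/2}(is) / i`. -/
noncomputable def axisWave (s : ℝ) : ℝ := s * (axisQuotient s).re

/-- The derivative `b'(s) = M'_{-i,1/2}(is)` of `axisWave`. -/
noncomputable def axisSlope (s : ℝ) : ℝ := (axisDeriv s).re

theorem whittakerM_axis_eq_zero_iff {r : ℝ} (hr : 0 < r) :
    whittakerM (-Complex.I) (1 / 2) (Complex.I * r) = 0 ↔ axisWave r = 0 := by
  rw [whittakerM_axis, axisWave]
  simp [hr.ne', Complex.ext_iff, (axis_im_eq_zero hr).1]

theorem deriv_whittakerM_axis_eq_zero_iff {r : ℝ} (hr : 0 < r) :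
    deriv (whittakerM (-Complex.I) (1 / 2)) (Complex.I * r) = 0 ↔ axisSlope r = 0 := by
  have h := (axis_im_eq_zero hr).2
  rw [(hasDerivAt_whittakerM _).deriv, axisSlope]
  simp only [axisDeriv] at h ⊢
  simp [Complex.ext_iff, h]

/-! ### The Prüfer angle of the Whittaker function -/

theorem hasDerivAt_axisWave (s : ℝ) : HasDerivAt axisWave (axisSlope s) s :=
  isAxisSolution_re.hasDerivAt_mul s

theorem hasDerivAt_axisSlope (s : ℝ) :
    HasDerivAt axisSlope (-(1 + s / 4) * (axisQuotient s).re) s :=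
  isAxisSolution_re.hasDerivAt_deriv s

theorem prufer_normSq_pos {s : ℝ} (hs : 0 ≤ s) : 0 < axisWave s ^ 2 + 4 * axisSlope s ^ 2 :=
  isAxisSolution_re.normSq_pos (by simp [axisDeriv_zero]) hs

/-- The angular velocity `1/2 + 2 b² / (s (b² + 4 b'²))` of the vector `(2 b', b)`, continuously
extended to `s ≤ 0` by its value `1/2` at `s = 0`. -/
noncomputable def pruferSpeed (s : ℝ) : ℝ :=
  1 / 2 + 2 * max s 0 * (axisQuotient (max s 0)).re ^ 2
    / (axisWave (max s 0) ^ 2 + 4 * axisSlope (max s 0) ^ 2)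

/-- The angle `A(s)` of the vector `(2 b'(s), b(s))`, continuous with `A(0) = 0`. -/
noncomputable def pruferAngle (s : ℝ) : ℝ := ∫ t in (0 : ℝ)..s, pruferSpeed t

theorem continuous_pruferSpeed : Continuous pruferSpeed := by
  have h1 : Continuous fun s => (axisQuotient s).re := isAxisSolution_re.continuous
  have h2 : Continuous axisSlope := isAxisSolution_re.continuous_deriv
  have h3 : Continuous axisWave := continuous_id.mul h1
  have hm : Continuous fun s : ℝ => max s 0 := by fun_prop
  have h1' := h1.comp hm
  have h2' := h2.comp hm
  have h3' := h3.comp hm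
  exact continuous_const.add (((continuous_const.mul hm).mul (h1'.pow 2)).div
    ((h3'.pow 2).add (continuous_const.mul (h2'.pow 2)))
    fun s => (prufer_normSq_pos (le_max_right s 0)).ne')

theorem half_le_pruferSpeed (s : ℝ) : 1 / 2 ≤ pruferSpeed s := by
  have := prufer_normSq_pos (le_max_right s 0)
  have h : 0 ≤ max s 0 := le_max_right s 0
  unfold pruferSpeed
  have : 0 ≤ 2 * max s 0 * (axisQuotient (max s 0)).re ^ 2
    / (axisWave (max s 0) ^ 2 + 4 * axisSlope (max s 0) ^ 2) := by positivity
  linarith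

theorem pruferAngle_zero : pruferAngle 0 = 0 := by simp [pruferAngle]

theorem hasDerivAt_pruferAngle (s : ℝ) : HasDerivAt pruferAngle (pruferSpeed s) s :=
  intervalIntegral.integral_hasDerivAt_right (continuous_pruferSpeed.intervalIntegrable _ _)
    (continuous_pruferSpeed.stronglyMeasurableAtFilter _ _) continuous_pruferSpeed.continuousAt

theorem continuous_pruferAngle : Continuous pruferAngle :=
  continuous_iff_continuousAt.2 fun s => (hasDerivAt_pruferAngle s).continuousAt

theorem strictMono_pruferAngle : StrictMono pruferAngle :=
  strictMono_of_hasDerivAt_pos hasDerivAt_pruferAngle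
    fun s => lt_of_lt_of_le (by norm_num) (half_le_pruferSpeed s)

theorem monotone_pruferAngle_sub_half : Monotone fun s => pruferAngle s - s / 2 :=
  monotone_of_hasDerivAt_nonneg
    (fun s => (hasDerivAt_pruferAngle s).sub ((hasDerivAt_id s).div_const 2))
    fun s => by have := half_le_pruferSpeed s; simp; linarith

theorem surjective_pruferAngle : Function.Surjective pruferAngle := by
  refine continuous_pruferAngle.surjective ?_ ?_
  · refine tendsto_atTop_mono' _ ?_ (tendsto_id.atTop_div_const (by norm_num : (0 : ℝ) < 2))
    filter_upwards [eventually_ge_atTop 0] with s hs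
    have := monotone_pruferAngle_sub_half hs
    simp [pruferAngle_zero] at this
    simpa using this
  · refine tendsto_atBot_mono' _ ?_ (tendsto_id.atBot_div_const (by norm_num : (0 : ℝ) < 2))
    filter_upwards [eventually_le_atBot 0] with s hs
    have := monotone_pruferAngle_sub_half hs
    simp [pruferAngle_zero] at this
    simpa using this

/-- The vector `(2 b', b)` is parallel to `(cos A, sin A)`: the quotient
`(b cos A - 2 b' sin A)² / (b² + 4 b'²)` is constant, and it vanishes at `0`. -/
theorem prufer_parallel {s : ℝ} (hs : 0 ≤ s) :
    axisWave s * Real.cos (pruferAngle s) = 2 * axisSlope s * Real.sin (pruferAngle s) := by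
  set f : ℝ → ℝ := fun s => (axisWave s * Real.cos (pruferAngle s)
    - 2 * axisSlope s * Real.sin (pruferAngle s)) ^ 2 / (axisWave s ^ 2 + 4 * axisSlope s ^ 2)
    with hf
  have hder : ∀ t, 0 ≤ t → HasDerivAt f 0 t := by
    intro t ht
    have hpos := prufer_normSq_pos ht
    have hb := hasDerivAt_axisWave t
    have hd := hasDerivAt_axisSlope t
    have hA := hasDerivAt_pruferAngle t
    have h := (((hb.mul hA.cos).sub ((hd.const_mul 2).mul hA.sin)).pow 2).div
      ((hb.pow 2).add ((hd.pow 2).const_mul 4)) hpos.ne'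
    convert! h using 1
    have hw : axisWave t = t * (axisQuotient t).re := rfl
    have hsp : pruferSpeed t * (axisWave t ^ 2 + 4 * axisSlope t ^ 2)
        = 1 / 2 * (axisWave t ^ 2 + 4 * axisSlope t ^ 2) + 2 * t * (axisQuotient t).re ^ 2 := by
      rw [pruferSpeed, max_eq_left ht]
      field_simp
    simp only [Pi.pow_apply, Pi.mul_apply, Pi.sub_apply, Pi.add_apply]
    rw [eq_comm, div_eq_zero_iff]
    left
    rw [hw] at hsp ⊢
    set x := axisSlope t
    set q := (axisQuotient t).re
    set c := Real.cos (pruferAngle t)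
    set n := Real.sin (pruferAngle t)
    set v := pruferSpeed t
    push_cast
    simp only [pow_one]
    linear_combination (-2 * (t * q * c - 2 * x * n) * (t * q * n + 2 * x * c)) * hsp
  have hconst : f s = f 0 := by
    refine constant_of_has_deriv_right_zero (a := 0) (b := s) ?_ ?_ s ⟨hs, le_rfl⟩
    · exact fun t ht => (hder t ht.1).continuousAt.continuousWithinAt
    · exact fun t ht => (hder t ht.1).hasDerivWithinAt
  have h0 : f 0 = 0 := by simp [hf, axisWave, pruferAngle_zero]
  rw [h0, hf] at hconst
  simp only [div_eq_zero_iff, (prufer_normSq_pos hs).ne', or_false] at hconst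
  linarith [pow_eq_zero_iff (two_ne_zero) |>.1 hconst]

theorem prufer_sin_sq {s : ℝ} (hs : 0 ≤ s) :
    axisWave s ^ 2
      = (axisWave s ^ 2 + 4 * axisSlope s ^ 2) * Real.sin (pruferAngle s) ^ 2 := by
  have h := congrArg (· ^ 2) (prufer_parallel hs)
  linear_combination h - axisWave s ^ 2 * Real.sin_sq_add_cos_sq (pruferAngle s)

theorem axisWave_eq_zero_iff {s : ℝ} (hs : 0 ≤ s) :
    axisWave s = 0 ↔ Real.sin (pruferAngle s) = 0 := by
  have h1 := prufer_sin_sq hs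
  have h2 := prufer_normSq_pos hs
  constructor
  · intro h
    have h3 : (axisWave s ^ 2 + 4 * axisSlope s ^ 2) * Real.sin (pruferAngle s) ^ 2 = 0 := by
      rw [← h1, h]; simp
    simpa [h2.ne'] using h3
  · intro h
    rw [h] at h1
    simpa using h1

theorem axisSlope_eq_zero_iff {s : ℝ} (hs : 0 ≤ s) :
    axisSlope s = 0 ↔ Real.cos (pruferAngle s) = 0 := by
  have h1 := prufer_sin_sq hs
  have h2 := prufer_normSq_pos hs
  have h3 : 4 * axisSlope s ^ 2
      = (axisWave s ^ 2 + 4 * axisSlope s ^ 2) * Real.cos (pruferAngle s) ^ 2 := by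
    rw [Real.cos_sq']; linear_combination -h1
  constructor
  · intro h
    have h4 : (axisWave s ^ 2 + 4 * axisSlope s ^ 2) * Real.cos (pruferAngle s) ^ 2 = 0 := by
      rw [← h3, h]; simp
    exact pow_eq_zero_iff two_ne_zero |>.1 ((mul_eq_zero.1 h4).resolve_left h2.ne')
  · intro h
    rw [h] at h3
    simpa using h3

/-- The phase equation: the angle solves `s A' = s / 2 + 2 sin² A`. -/
theorem mul_pruferSpeed {s : ℝ} (hs : 0 ≤ s) :
    s * pruferSpeed s = s / 2 + 2 * Real.sin (pruferAngle s) ^ 2 := by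
  have h1 := prufer_sin_sq hs
  have h2 := prufer_normSq_pos hs
  have hw : axisWave s = s * (axisQuotient s).re := rfl
  have h3 : s * pruferSpeed s = s / 2 + 2 * axisWave s ^ 2
      / (axisWave s ^ 2 + 4 * axisSlope s ^ 2) := by
    rw [pruferSpeed, max_eq_left hs]
    nth_rewrite 2 [hw]
    ring
  rw [h3, mul_div_assoc]
  congr 2
  rw [div_eq_iff h2.ne', mul_comm]
  exact h1

/-- The linear bound that makes the angle integrable against `ds / s` near `s = 0`. -/
theorem exists_pruferAngle_le_mul {r : ℝ} (hr : 0 ≤ r) :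
    ∃ C, 0 ≤ C ∧ ∀ s ∈ Set.Icc 0 r, pruferAngle s ≤ C * s := by
  obtain ⟨C, hC⟩ := isCompact_Icc.bddAbove_image (f := pruferSpeed) (K := Set.Icc 0 r)
    continuous_pruferSpeed.continuousOn
  have hC' : ∀ s ∈ Set.Icc 0 r, pruferSpeed s ≤ C := fun s hs => hC ⟨s, hs, rfl⟩
  refine ⟨C, ?_, fun s hs => ?_⟩
  · linarith [hC' 0 ⟨le_rfl, hr⟩, half_le_pruferSpeed 0]
  · have := intervalIntegral.integral_mono_on (μ := MeasureTheory.volume) hs.1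
      (continuous_pruferSpeed.intervalIntegrable 0 s)
      (continuous_const.intervalIntegrable (μ := MeasureTheory.volume) 0 s)
      (fun t ht => hC' t ⟨ht.1, ht.2.trans hs.2⟩)
    simpa [pruferAngle, mul_comm] using this

/-! ### Global solutions of bounded Lipschitz differential equations -/

/-- Global existence for a time-dependent, bounded, globally Lipschitz vector field: the
Picard–Lindelöf solutions on the intervals `[-(n + 1), n + 1]` agree where they overlap. -/
theorem exists_global_solution_of_lipschitz_of_bounded {E : Type*} [NormedAddCommGroup E]
    [NormedSpace ℝ E] [CompleteSpace E] {v : ℝ → E → E} {K L : NNReal}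
    (hlip : ∀ t, LipschitzWith K (v t)) (hcont : ∀ x, Continuous fun t => v t x)
    (hbound : ∀ t x, ‖v t x‖ ≤ L) (x₀ : E) :
    ∃ φ : ℝ → E, φ 0 = x₀ ∧ ∀ t, HasDerivAt φ (v t (φ t)) t := by
  have hloc : ∀ n : ℕ, ∃ α : ℝ → E, α 0 = x₀ ∧
      ∀ t ∈ Set.Ioo (-((n : ℝ) + 1)) (n + 1), HasDerivAt α (v t (α t)) t := by
    intro n
    have hn : (0 : ℝ) ≤ (n : ℝ) + 1 := by positivity
    have hP : IsPicardLindelof v (tmin := -((n : ℝ) + 1)) (tmax := (n : ℝ) + 1)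
        ⟨0, by linarith, hn⟩ x₀ (L * (n + 1)) 0 L K :=
      { lipschitzOnWith := fun t _ => (hlip t).lipschitzOnWith
        continuousOn := fun x _ => (hcont x).continuousOn
        norm_le := fun t _ x _ => hbound t x
        mul_max_le := by simp }
    obtain ⟨α, h0, hα⟩ := hP.exists_eq_forall_mem_Icc_hasDerivWithinAt₀
    exact ⟨α, h0, fun t ht => (hα t ⟨ht.1.le, ht.2.le⟩).hasDerivAt (Icc_mem_nhds ht.1 ht.2)⟩
  choose α hα0 hα using hloc
  have hagree : ∀ n m : ℕ, n ≤ m → ∀ t : ℝ, |t| < n + 1 → α n t = α m t := by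
    intro n m hnm t ht
    have hnm' : (n : ℝ) ≤ m := by exact_mod_cast hnm
    refine ODE_solution_unique_of_mem_Ioo (v := v) (s := fun _ => Set.univ) (K := K) (t₀ := 0)
      (a := -((n : ℝ) + 1)) (b := n + 1) (fun t _ => (hlip t).lipschitzOnWith)
      ⟨by linarith [n.cast_nonneg (α := ℝ)], by positivity⟩
      (fun t ht => ⟨hα n t ht, trivial⟩)
      (fun t ht => ⟨hα m t ⟨by linarith [ht.1], by linarith [ht.2]⟩, trivial⟩)
      ((hα0 n).trans (hα0 m).symm) (abs_lt.1 ht)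
  refine ⟨fun t => α ⌈|t|⌉₊ t, hα0 _, fun t => ?_⟩
  have hlt : ∀ s : ℝ, |s| < (⌈|s|⌉₊ : ℝ) + 1 := fun s => by linarith [Nat.le_ceil |s|]
  have heq : ∀ s : ℝ, |s| < |t| + 1 → α ⌈|s|⌉₊ s = α (⌈|t|⌉₊ + 1) s := by
    intro s hs
    refine hagree _ _ (Nat.ceil_le.2 ?_) s (hlt s)
    push_cast
    linarith [Nat.le_ceil |t|]
  have hev : (fun t => α ⌈|t|⌉₊ t) =ᶠ[𝓝 t] α (⌈|t|⌉₊ + 1) := by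
    filter_upwards [continuous_abs.continuousAt.eventually_lt
      (continuousAt_const (y := |t| + 1)) (lt_add_one |t|)] with s hs
    exact heq s hs
  have hder := hα (⌈|t|⌉₊ + 1) t (abs_lt.1 (by push_cast; linarith [hlt t]))
  simp only [heq t (lt_add_one _)]
  exact hder.congr_of_eventuallyEq hev

/-! ### The phase equation -/

theorem sin_sub_mul_sin_add (x y : ℝ) :
    Real.sin (x - y) * Real.sin (x + y) = Real.sin x ^ 2 - Real.sin y ^ 2 := by
  rw [Real.sin_sub, Real.sin_add]
  linear_combination Real.sin x ^ 2 * Real.sin_sq_add_cos_sq y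
    - Real.sin y ^ 2 * Real.sin_sq_add_cos_sq x

theorem abs_sin_sq_sub_sin_sq_le (x y : ℝ) : |Real.sin x ^ 2 - Real.sin y ^ 2| ≤ |x - y| := by
  rw [← sin_sub_mul_sin_add, abs_mul]
  calc _ ≤ |x - y| * 1 :=
        mul_le_mul Real.abs_sin_le_abs (Real.abs_sin_le_one _) (abs_nonneg _) (abs_nonneg _)
    _ = _ := mul_one _

/-- The equation for the half angle `φ = Θ / 2` in the time `t = tan z`, at energy `E = 1`. -/
noncomputable def phaseField (γ t x : ℝ) : ℝ := -2 * Real.sin x ^ 2 - γ / 2 * Real.exp (-|t|)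

/-- `φ` is a solution of the phase equation on all of `ℝ`. -/
def IsPhase (γ : ℝ) (φ : ℝ → ℝ) : Prop := ∀ t, HasDerivAt φ (phaseField γ t (φ t)) t

/-- The solution on `t ≤ 0` that leaves `0` exponentially fast, like `-γ eᵗ / 2`, whereas the other
solutions leave it like `1 / (2 t)`. It is, up to sign, the Prüfer angle of the Whittaker function
at `s = γ eᵗ`. For `t > 0` it does not solve the phase equation. -/
noncomputable def fastPhase (γ t : ℝ) : ℝ := -pruferAngle (γ * Real.exp t)

theorem exists_isPhase (γ x₀ : ℝ) : ∃ φ, IsPhase γ φ ∧ φ 0 = x₀ := by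
  refine (exists_global_solution_of_lipschitz_of_bounded (v := phaseField γ) (K := 2)
    (L := 2 + ‖γ / 2‖₊) ?_ ?_ ?_ x₀).imp fun φ h => ⟨h.2, h.1⟩
  · intro t
    refine LipschitzWith.of_dist_le_mul fun x y => ?_
    rw [Real.dist_eq, Real.dist_eq, phaseField, phaseField]
    have : -2 * Real.sin x ^ 2 - γ / 2 * Real.exp (-|t|)
      - (-2 * Real.sin y ^ 2 - γ / 2 * Real.exp (-|t|))
        = -2 * (Real.sin x ^ 2 - Real.sin y ^ 2) := by ring
    rw [this, abs_mul]
    simpa using abs_sin_sq_sub_sin_sq_le x y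
  · intro x
    unfold phaseField
    fun_prop
  · intro t x
    have h1 : ‖-2 * Real.sin x ^ 2‖ ≤ 2 := by
      rw [Real.norm_eq_abs, abs_mul, abs_of_nonneg (sq_nonneg (Real.sin x))]
      norm_num
      exact Real.abs_sin_le_one x
    have h2 : ‖γ / 2 * Real.exp (-|t|)‖ ≤ ‖γ / 2‖ * 1 := by
      rw [norm_mul]
      gcongr
      rw [Real.norm_eq_abs, abs_of_pos (Real.exp_pos _), Real.exp_le_one_iff]
      simp
    calc _ ≤ _ := norm_sub_le _ _
      _ ≤ 2 + ‖γ / 2‖ * 1 := add_le_add h1 h2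
      _ = _ := by simp

theorem sin_add_int_mul_pi_sq (x : ℝ) (n : ℤ) :
    Real.sin (x + n * Real.pi) ^ 2 = Real.sin x ^ 2 := by
  rw [Real.sin_add_int_mul_pi, mul_pow]
  rcases Int.even_or_odd n with h | h <;> simp [h.neg_one_zpow]

theorem sin_int_mul_pi_sub_sq (x : ℝ) (n : ℤ) :
    Real.sin (n * Real.pi - x) ^ 2 = Real.sin x ^ 2 := by
  rw [sub_eq_neg_add, sin_add_int_mul_pi_sq, Real.sin_neg, neg_sq]

namespace IsPhase

variable {γ : ℝ} {φ ψ : ℝ → ℝ}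

theorem continuous (h : IsPhase γ φ) : Continuous φ :=
  continuous_iff_continuousAt.2 fun t => (h t).continuousAt

theorem antitone (h : IsPhase γ φ) (hγ : 0 ≤ γ) : Antitone φ :=
  antitone_of_hasDerivAt_nonpos h fun t => by
    have h1 : 0 ≤ γ / 2 * Real.exp (-|t|) := by positivity
    have h2 := sq_nonneg (Real.sin (φ t))
    simp only [phaseField]
    show _ ≤ (0 : ℝ)
    linarith

theorem add_int_mul_pi (h : IsPhase γ φ) (n : ℤ) : IsPhase γ fun t => φ t + n * Real.pi := by
  intro t
  simp only [phaseField, sin_add_int_mul_pi_sq]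
  exact (h t).add_const _

/-- The reversing symmetry `t ↦ -t`, `φ ↦ -φ`, combined with a deck transformation. -/
theorem reflect (h : IsPhase γ φ) (n : ℤ) : IsPhase γ fun t => n * Real.pi - φ (-t) := by
  intro t
  have h1 := ((h (-t)).comp t (hasDerivAt_neg t)).const_sub (n * Real.pi)
  convert! h1 using 1
  simp only [phaseField, sin_int_mul_pi_sub_sq, abs_neg]
  ring

end IsPhase

/-- The difference of two solutions solves the linear equation `δ' = -c δ` with the coefficient
`c = 2 sinc (φ - ψ) sin (φ + ψ)`. -/
theorem phase_sub_eq_mul_exp {γ : ℝ} {φ ψ : ℝ → ℝ} (hφ : Continuous φ) (hψ : Continuous ψ)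
    (hφ' : ∀ t ≤ 0, HasDerivAt φ (phaseField γ t (φ t)) t)
    (hψ' : ∀ t ≤ 0, HasDerivAt ψ (phaseField γ t (ψ t)) t) {t : ℝ} (ht : t ≤ 0) :
    φ 0 - ψ 0 = (φ t - ψ t)
      * Real.exp (∫ τ in (0 : ℝ)..t, 2 * Real.sinc (φ τ - ψ τ) * Real.sin (φ τ + ψ τ)) := by
  set c : ℝ → ℝ := fun τ => 2 * Real.sinc (φ τ - ψ τ) * Real.sin (φ τ + ψ τ) with hc
  have hcc : Continuous c :=
    (continuous_const.mul (Real.continuous_sinc.comp (hφ.sub hψ))).mul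
      (Real.continuous_sin.comp (hφ.add hψ))
  have hI : ∀ t, HasDerivAt (fun t => ∫ τ in (0 : ℝ)..t, c τ) (c t) t := fun t =>
    intervalIntegral.integral_hasDerivAt_right (hcc.intervalIntegrable _ _)
      (hcc.stronglyMeasurableAtFilter _ _) hcc.continuousAt
  have hder : ∀ s ≤ 0, HasDerivAt
      (fun t => (φ t - ψ t) * Real.exp (∫ τ in (0 : ℝ)..t, c τ)) 0 s := by
    intro s hs
    convert! ((hφ' s hs).sub (hψ' s hs)).mul (hI s).exp using 1
    have h1 : Real.sinc (φ s - ψ s) * (φ s - ψ s) = Real.sin (φ s - ψ s) := by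
      by_cases h : φ s - ψ s = 0
      · simp [h]
      · rw [Real.sinc_of_ne_zero h, div_mul_cancel₀ _ h]
    have h2 := sin_sub_mul_sin_add (φ s) (ψ s)
    simp only [hc, phaseField, Pi.sub_apply]
    linear_combination (-2 * Real.exp (∫ τ in (0 : ℝ)..s, c τ)) *
      (h2 + Real.sin (φ s + ψ s) * h1)
  have hconst := constant_of_has_deriv_right_zero (a := t) (b := 0)
    (fun s hs => (hder s hs.2).continuousAt.continuousWithinAt)
    (fun s hs => (hder s hs.2.le).hasDerivWithinAt) 0 ⟨ht, le_rfl⟩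
  simpa using hconst

section FastPhase

variable {γ : ℝ} {φ : ℝ → ℝ}

theorem continuous_fastPhase : Continuous (fastPhase γ) :=
  (continuous_pruferAngle.comp (continuous_const.mul Real.continuous_exp)).neg

theorem fastPhase_zero : fastPhase γ 0 = -pruferAngle γ := by simp [fastPhase]

theorem fastPhase_nonpos (hγ : 0 ≤ γ) (t : ℝ) : fastPhase γ t ≤ 0 := by
  have := strictMono_pruferAngle.monotone (show 0 ≤ γ * Real.exp t by positivity)
  rw [pruferAngle_zero] at this
  unfold fastPhase
  linarith

theorem hasDerivAt_fastPhase (hγ : 0 ≤ γ) {t : ℝ} (ht : t ≤ 0) :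
    HasDerivAt (fastPhase γ) (phaseField γ t (fastPhase γ t)) t := by
  have h := ((hasDerivAt_pruferAngle (γ * Real.exp t)).comp t
    ((Real.hasDerivAt_exp t).const_mul γ)).neg
  convert! h using 1
  have h1 := mul_pruferSpeed (s := γ * Real.exp t) (by positivity)
  simp only [phaseField, fastPhase, Real.sin_neg, abs_of_nonpos ht, neg_neg]
  linear_combination h1

theorem tendsto_fastPhase : Tendsto (fastPhase γ) atBot (𝓝 0) := by
  have h1 : Tendsto (fun t => γ * Real.exp t) atBot (𝓝 0) := by
    simpa using Real.tendsto_exp_atBot.const_mul γ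
  have h2 := ((continuous_pruferAngle.tendsto 0).comp h1).neg
  rw [pruferAngle_zero, neg_zero] at h2
  exact h2

theorem IsPhase.sub_fastPhase (h : IsPhase γ φ) (hγ : 0 ≤ γ) {t : ℝ} (ht : t ≤ 0) :
    φ 0 + pruferAngle γ = (φ t - fastPhase γ t)
      * Real.exp (∫ τ in (0 : ℝ)..t,
        2 * Real.sinc (φ τ - fastPhase γ τ) * Real.sin (φ τ + fastPhase γ τ)) := by
  rw [← phase_sub_eq_mul_exp h.continuous continuous_fastPhase (fun t _ => h t)
    (fun t ht => hasDerivAt_fastPhase hγ ht) ht, fastPhase_zero, sub_neg_eq_add]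

theorem IsPhase.le_fastPhase_iff (h : IsPhase γ φ) (hγ : 0 ≤ γ) {t : ℝ} (ht : t ≤ 0) :
    φ t ≤ fastPhase γ t ↔ φ 0 ≤ -pruferAngle γ := by
  have h1 := h.sub_fastPhase hγ ht
  rw [← sub_nonpos, ← sub_nonpos (a := φ 0), sub_neg_eq_add, h1]
  exact (mul_le_mul_iff_left₀ (Real.exp_pos _)).symm.trans (by rw [zero_mul])

/-- Among the solutions that emanate from `0`, the fast one is the largest: a larger one would
be squeezed between it and `0`, so that the coefficient of the linear equation for the difference
is `O(eᵗ)`, hence integrable, and the difference could not tend to `0`. -/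
theorem IsPhase.apply_zero_le_of_tendsto (h : IsPhase γ φ) (hγ : 0 ≤ γ)
    (hlim : Tendsto φ atBot (𝓝 0)) : φ 0 ≤ -pruferAngle γ := by
  by_contra! hlt
  obtain ⟨C, hC0, hC⟩ := exists_pruferAngle_le_mul hγ
  have hneg : ∀ t, φ t ≤ 0 := fun t => (h.antitone hγ).ge_of_tendsto hlim t
  have hexp : ∀ t ≤ 0, fastPhase γ t < φ t := fun t ht => by
    rw [← not_le, h.le_fastPhase_iff hγ ht, not_le]; exact hlt
  have hsmall : ∀ t ≤ 0, -(C * γ * Real.exp t) ≤ fastPhase γ t := by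
    intro t ht
    have h1 : Real.exp t ≤ 1 := Real.exp_le_one_iff.2 ht
    have := hC (γ * Real.exp t) ⟨by positivity, by nlinarith⟩
    unfold fastPhase
    linarith
  set c : ℝ → ℝ := fun τ =>
    2 * Real.sinc (φ τ - fastPhase γ τ) * Real.sin (φ τ + fastPhase γ τ) with hc
  have hcb : ∀ t ≤ 0, |c t| ≤ 4 * C * γ * Real.exp t := by
    intro t ht
    have h1 : |φ t + fastPhase γ t| ≤ 2 * (C * γ * Real.exp t) := by
      rw [abs_le]
      constructor <;> linarith [hsmall t ht, hexp t ht, hneg t, fastPhase_nonpos hγ t]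
    calc |c t| = 2 * |Real.sinc (φ t - fastPhase γ t)|
          * |Real.sin (φ t + fastPhase γ t)| := by
          simp only [hc, abs_mul, abs_two]
      _ ≤ 2 * 1 * |φ t + fastPhase γ t| := by
          refine mul_le_mul ?_ Real.abs_sin_le_abs (abs_nonneg _) (by norm_num)
          gcongr
          exact Real.abs_sinc_le_one _
      _ ≤ 2 * 1 * (2 * (C * γ * Real.exp t)) := by gcongr
      _ = _ := by ring
  have hint : ∀ t ≤ 0, ∫ τ in (0 : ℝ)..t, c τ ≤ 4 * C * γ := by
    intro t ht
    have h1 := intervalIntegral.norm_integral_le_of_norm_le (μ := MeasureTheory.volume) ht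
      (f := c) (g := fun τ => 4 * C * γ * Real.exp τ)
      (MeasureTheory.ae_of_all _ fun τ hτ => hcb τ hτ.2)
      ((continuous_const.mul Real.continuous_exp).intervalIntegrable _ _)
    rw [intervalIntegral.integral_const_mul, integral_exp, Real.exp_zero] at h1
    rw [intervalIntegral.integral_symm]
    have h2 := (abs_le.1 h1).1
    have h3 : 0 ≤ 4 * C * γ * Real.exp t := by positivity
    linarith
  have hle : ∀ t ≤ 0, φ 0 + pruferAngle γ
      ≤ (φ t - fastPhase γ t) * Real.exp (4 * C * γ) := by
    intro t ht
    rw [h.sub_fastPhase hγ ht]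
    exact mul_le_mul_of_nonneg_left (Real.exp_le_exp.2 (hint t ht)) (by linarith [hexp t ht])
  have hlim' := (hlim.sub (tendsto_fastPhase (γ := γ))).mul_const (Real.exp (4 * C * γ))
  have := ge_of_tendsto hlim' (by
    filter_upwards [eventually_le_atBot 0] with t ht using hle t ht)
  linarith

theorem IsPhase.lt_apply_zero_of_tendsto (h : IsPhase γ φ) (hγ : 0 ≤ γ)
    (hlim : Tendsto φ atBot (𝓝 0)) : -pruferAngle γ - Real.pi < φ 0 := by
  by_contra! hle
  have h1 := h.add_int_mul_pi 1
  have h2 : ∀ t ≤ 0, φ t + Real.pi ≤ fastPhase γ t := fun t ht => by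
    simpa using (h1.le_fastPhase_iff hγ ht).2 (by simp; linarith)
  have h3 := le_of_tendsto_of_tendsto (hlim.add_const Real.pi) (tendsto_fastPhase (γ := γ))
    (by filter_upwards [eventually_le_atBot 0] with t ht using h2 t ht)
  linarith [Real.pi_pos]

/-- A solution that converges as `t → -∞` converges to an equilibrium. -/
theorem IsPhase.sin_eq_zero_of_tendsto {ℓ : ℝ} (h : IsPhase γ φ) (hγ : 0 ≤ γ)
    (hlim : Tendsto φ atBot (𝓝 ℓ)) : Real.sin ℓ = 0 := by
  by_contra hne
  set c := Real.sin ℓ ^ 2 with hc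
  have hc0 : 0 < c := by positivity
  have hs : Tendsto (fun t => Real.sin (φ t) ^ 2) atBot (𝓝 c) :=
    ((Real.continuous_sin.tendsto ℓ).comp hlim).pow 2
  obtain ⟨T, hT⟩ := eventually_atBot.1 (hs.eventually_const_lt (show c / 2 < c by linarith))
  -- below `T` the solution has slope at most `-c`, hence is unbounded
  have hanti : AntitoneOn (fun t => φ t + c * t) (Set.Iic T) := by
    refine antitoneOn_of_hasDerivWithinAt_nonpos (convex_Iic T)
      (h.continuous.add (continuous_const.mul continuous_id)).continuousOn
      (f' := fun t => phaseField γ t (φ t) + c * 1)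
      (fun t _ => ((h t).add ((hasDerivAt_id t).const_mul c)).hasDerivWithinAt) fun t ht => ?_
    rw [interior_Iic] at ht
    have h1 := hT t (le_of_lt ht)
    have h2 : 0 ≤ γ / 2 * Real.exp (-|t|) := by positivity
    simp only [phaseField]
    linarith
  have hub : ∀ t, φ t ≤ ℓ := fun t => (h.antitone hγ).ge_of_tendsto hlim t
  have hd : 0 ≤ (ℓ - φ T + 1) / c := by have := hub T; apply div_nonneg <;> linarith
  have h1 := hanti (show T - (ℓ - φ T + 1) / c ∈ Set.Iic T by simp; exact hd)
    (Set.mem_Iic.2 le_rfl) (by linarith)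
  have h2 := hub (T - (ℓ - φ T + 1) / c)
  have h3 : c * (T - (ℓ - φ T + 1) / c) = c * T - (ℓ - φ T + 1) := by field_simp
  simp only [h3] at h1
  linarith

/-- The solutions that emanate from `0` fill the strip of width `π` below the fast one. -/
theorem IsPhase.tendsto_zero (h : IsPhase γ φ) (hγ : 0 ≤ γ)
    (hlow : -pruferAngle γ - Real.pi < φ 0) (hup : φ 0 ≤ -pruferAngle γ) :
    Tendsto φ atBot (𝓝 0) := by
  have hanti := h.antitone hγ
  have hle : ∀ t ≤ 0, φ t ≤ fastPhase γ t := fun t ht => (h.le_fastPhase_iff hγ ht).2 hup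
  have hbdd : ∀ t, φ t ≤ 0 := fun t =>
    (hanti (min_le_left t 0)).trans
      ((hle _ (min_le_right t 0)).trans (fastPhase_nonpos hγ _))
  obtain ⟨ℓ, hℓ⟩ : ∃ ℓ, Tendsto φ atBot (𝓝 ℓ) :=
    ⟨_, tendsto_atBot_ciSup hanti ⟨0, by rintro _ ⟨t, rfl⟩; exact hbdd t⟩⟩
  have hℓ0 : ℓ ≤ 0 := le_of_tendsto' hℓ hbdd
  have h1 := h.add_int_mul_pi 1
  have hge : ∀ t ≤ 0, fastPhase γ t ≤ φ t + Real.pi := fun t ht => by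
    have := (not_congr (h1.le_fastPhase_iff hγ ht)).2 (by simp; linarith)
    simpa using (not_le.1 this).le
  have hℓπ : 0 ≤ ℓ + Real.pi := le_of_tendsto_of_tendsto (tendsto_fastPhase (γ := γ))
    (hℓ.add_const Real.pi) (by
      filter_upwards [eventually_le_atBot 0] with t ht using hge t ht)
  rcases hℓ0.eq_or_lt with rfl | hneg
  · exact hℓ
  · exfalso
    have hsin := h.sin_eq_zero_of_tendsto hγ hℓ
    have hℓ' : ℓ + Real.pi = 0 := by
      rcases hℓπ.eq_or_lt with h0 | h0
      · exact h0.symm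
      · have := Real.sin_neg_of_neg_of_neg_pi_lt hneg (by linarith)
        linarith
    have h2 := h1.apply_zero_le_of_tendsto hγ (by
      have := hℓ.add_const Real.pi
      rw [hℓ'] at this
      simpa using this)
    simp at h2
    linarith

end FastPhase

/-- Upper bound for the rotation of a phase: the limit at `-∞` bounds `φ 0` from below and, by
reflection, the limit at `+∞` bounds it from above. -/
theorem IsPhase.rotation_lt {γ : ℝ} {φ : ℝ → ℝ} (h : IsPhase γ φ) (hγ : 0 ≤ γ) {n m : ℤ}
    (hn : Tendsto φ atBot (𝓝 (n * Real.pi))) (hm : Tendsto φ atTop (𝓝 (m * Real.pi))) :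
    (n - m) * Real.pi < 2 * pruferAngle γ + 2 * Real.pi := by
  have h1 := (h.add_int_mul_pi (-n)).lt_apply_zero_of_tendsto hγ (by
    simpa using hn.add_const (((-n : ℤ) : ℝ) * Real.pi))
  have h2 := (h.reflect m).lt_apply_zero_of_tendsto hγ (by
    simpa using (hm.comp tendsto_neg_atBot_atTop).const_sub (m * Real.pi))
  simp at h1 h2
  linarith

/-- The phase with `φ 0 = -w π / 2` is symmetric under the reversing symmetry; it rotates by `w π`
as soon as it emanates from `0`. -/
theorem exists_isPhase_rotation {γ : ℝ} (hγ : 0 ≤ γ) (w : ℤ)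
    (h1 : pruferAngle γ ≤ w * Real.pi / 2)
    (h2 : w * Real.pi / 2 < pruferAngle γ + Real.pi) :
    ∃ φ, IsPhase γ φ ∧ Tendsto φ atBot (𝓝 0) ∧ Tendsto φ atTop (𝓝 (-(w * Real.pi))) := by
  obtain ⟨φ, hφ, h0⟩ := exists_isPhase γ (-(w * Real.pi / 2))
  refine ⟨φ, hφ, hφ.tendsto_zero hγ (by linarith) (by linarith), ?_⟩
  have h3 := (hφ.reflect (-w)).tendsto_zero hγ (by simp; linarith) (by simp; linarith)
  have h4 := (h3.comp tendsto_neg_atTop_atBot).const_sub (((-w : ℤ) : ℝ) * Real.pi)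
  simpa [Function.comp_def] using h4

/-! ### Heteroclinic orbits as phases -/

theorem screenedPotential_of_cos_ne_zero {z : ℝ} (h : Real.cos z ≠ 0) :
    screenedPotential z = Real.exp (-|Real.tan z|) := if_neg h

theorem IsPhase.isHeteroclinicOrbit {γ : ℝ} {φ : ℝ → ℝ} (h : IsPhase γ φ) {n m : ℤ}
    (hn : Tendsto φ atBot (𝓝 (n * Real.pi))) (hm : Tendsto φ atTop (𝓝 (m * Real.pi))) :
    IsHeteroclinicOrbit γ 1 (fun τ => (Real.arctan τ, 2 * φ τ))
      (-(Real.pi / 2), n * (2 * Real.pi)) (Real.pi / 2, m * (2 * Real.pi)) where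
  mem_strip τ := ⟨(Real.neg_pi_div_two_lt_arctan τ).le, (Real.arctan_lt_pi_div_two τ).le⟩
  solution τ := by
    have h1 := (Real.hasDerivAt_arctan τ).prodMk ((h τ).const_mul 2)
    convert! h1 using 1
    have h2 : Real.cos (Real.arctan τ) ≠ 0 := (Real.cos_arctan_pos τ).ne'
    simp only [diracField, screenedPotential_of_cos_ne_zero h2, Real.tan_arctan,
      Real.cos_sq_arctan, phaseField, Real.cos_two_mul, Real.cos_sq' (φ τ)]
    ext
    · rfl
    · ring
  source_eq := by
    refine ⟨⟨le_rfl, by linarith [Real.pi_pos]⟩, ?_⟩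
    simp [diracField, screenedPotential, Real.cos_int_mul_two_pi]
  target_eq := by
    refine ⟨⟨by simp only; linarith [Real.pi_pos], le_rfl⟩, ?_⟩
    simp [diracField, screenedPotential, Real.cos_int_mul_two_pi]
  source_left := rfl
  target_right := rfl
  alpha_limit := by
    refine (Real.tendsto_arctan_atBot.mono_right nhdsWithin_le_nhds).prodMk_nhds ?_
    convert hn.const_mul 2 using 2
    ring
  omega_limit := by
    refine (Real.tendsto_arctan_atTop.mono_right nhdsWithin_le_nhds).prodMk_nhds ?_
    convert hm.const_mul 2 using 2
    ring

theorem windingNumber_int_mul_two_pi (z w : ℝ) (n m : ℤ) :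
    windingNumber (z, n * (2 * Real.pi)) (w, m * (2 * Real.pi)) = n - m := by
  have h : (n * (2 * Real.pi) - m * (2 * Real.pi)) / (2 * Real.pi) = ((n - m : ℤ) : ℝ) := by
    have := Real.pi_ne_zero
    push_cast
    field_simp
  rw [windingNumber, h, Int.floor_intCast]

theorem exists_isHeteroclinicOrbit {γ : ℝ} (hγ : 0 ≤ γ) (w : ℤ)
    (h1 : pruferAngle γ ≤ w * Real.pi / 2)
    (h2 : w * Real.pi / 2 < pruferAngle γ + Real.pi) :
    ∃ (y : ℝ → ℝ × ℝ) (p q : ℝ × ℝ), IsHeteroclinicOrbit γ 1 y p q ∧ windingNumber p q = w := by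
  obtain ⟨φ, hφ, hbot, htop⟩ := exists_isPhase_rotation hγ w h1 h2
  refine ⟨_, _, _, hφ.isHeteroclinicOrbit (n := 0) (m := -w) (by simpa using hbot)
    (by simpa using htop), ?_⟩
  rw [windingNumber_int_mul_two_pi]
  ring

/-- A boundary equilibrium at energy `1` has its angle in `2πℤ`. -/
theorem IsEquilibrium.exists_int_mul_two_pi {γ : ℝ} {x : ℝ × ℝ} (h : IsEquilibrium γ 1 x) :
    ∃ n : ℤ, (n : ℝ) * (2 * Real.pi) = x.2 := by
  have h1 : Real.cos x.1 ^ 2 = 0 := congrArg Prod.fst h.2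
  have h2 : 2 * Real.cos x.2 - γ * screenedPotential x.1 - 2 * 1 = 0 := congrArg Prod.snd h.2
  rw [screenedPotential, if_pos (by simpa using h1)] at h2
  exact (Real.cos_eq_one_iff _).1 (by linarith)

/-- On a heteroclinic orbit `tan z` is, up to a constant, the time, so the half angle is a phase
after a translation in time. -/
theorem IsHeteroclinicOrbit.exists_isPhase {γ : ℝ} {y : ℝ → ℝ × ℝ} {p q : ℝ × ℝ}
    (h : IsHeteroclinicOrbit γ 1 y p q) :
    ∃ φ, IsPhase γ φ ∧ Tendsto φ atBot (𝓝 (p.2 / 2)) ∧ Tendsto φ atTop (𝓝 (q.2 / 2)) := by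
  have hz : ∀ τ, HasDerivAt (fun τ => (y τ).1) (Real.cos (y τ).1 ^ 2) τ := fun τ =>
    (hasFDerivAt_fst (p := y τ)).comp_hasDerivAt τ (h.solution τ)
  have hθ : ∀ τ, HasDerivAt (fun τ => (y τ).2)
      (2 * Real.cos (y τ).2 - γ * screenedPotential (y τ).1 - 2 * 1) τ := fun τ =>
    (hasFDerivAt_snd (p := y τ)).comp_hasDerivAt τ (h.solution τ)
  -- an orbit that meets a boundary circle stays on it, so it cannot join the two circles
  have hcos : ∀ τ, Real.cos (y τ).1 ≠ 0 := by
    intro τ₀ h0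
    have hconst : (fun τ => (y τ).1) = fun _ => (y τ₀).1 := by
      refine ODE_solution_unique_univ (v := fun _ x => Real.cos x ^ 2) (s := fun _ => Set.univ)
        (K := 1) (t₀ := τ₀) (fun t => LipschitzWith.lipschitzOnWith ?_)
        (fun t => ⟨hz t, trivial⟩) (fun t => ⟨?_, trivial⟩) rfl
      · refine LipschitzWith.of_dist_le_mul fun x x' => ?_
        rw [Real.dist_eq, Real.dist_eq, Real.cos_sq', Real.cos_sq']
        have := abs_sin_sq_sub_sin_sq_le x' x
        rw [NNReal.coe_one, one_mul, abs_sub_comm x x']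
        convert this using 2
        ring
      · simpa [h0] using hasDerivAt_const t (y τ₀).1
    have h1 := (continuous_fst.tendsto p).comp h.alpha_limit
    have h2 := (continuous_fst.tendsto q).comp h.omega_limit
    have h3 : Prod.fst ∘ y = fun _ => (y τ₀).1 := hconst
    rw [h3] at h1 h2
    have h4 := tendsto_nhds_unique h1 tendsto_const_nhds
    have h5 := tendsto_nhds_unique h2 tendsto_const_nhds
    rw [h.source_left] at h4
    rw [h.target_right] at h5
    linarith [Real.pi_pos]
  have htan : ∀ τ, HasDerivAt (fun τ => Real.tan (y τ).1 - τ) 0 τ := by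
    intro τ
    convert! ((Real.hasDerivAt_tan (hcos τ)).comp τ (hz τ)).sub (hasDerivAt_id τ) using 1
    have := hcos τ
    field_simp
    ring
  set c := Real.tan (y 0).1 with hc
  have htan' : ∀ τ, Real.tan (y τ).1 = τ + c := by
    intro τ
    have := is_const_of_deriv_eq_zero (fun τ => (htan τ).differentiableAt)
      (fun τ => (htan τ).deriv) τ 0
    simp only [sub_zero] at this
    linarith
  refine ⟨fun t => (y (t - c)).2 / 2, fun t => ?_, ?_, ?_⟩
  · have h1 := ((hθ (t - c)).comp t ((hasDerivAt_id t).sub_const c)).div_const 2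
    convert! h1 using 1
    rw [screenedPotential_of_cos_ne_zero (hcos _), htan', sub_add_cancel, phaseField]
    have h2 : Real.cos (y (t - c)).2 = 1 - 2 * Real.sin ((y (t - c)).2 / 2) ^ 2 := by
      rw [Real.sin_sq_eq_half_sub, mul_div_cancel₀ _ (two_ne_zero)]
      ring
    rw [h2]
    ring
  · exact (((continuous_snd.tendsto p).comp h.alpha_limit).comp
      (tendsto_atBot_add_const_right _ (-c) tendsto_id)).div_const 2
  · exact (((continuous_snd.tendsto q).comp h.omega_limit).comp
      (tendsto_atTop_add_const_right _ (-c) tendsto_id)).div_const 2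

theorem IsHeteroclinicOrbit.windingNumber_mul_pi_lt {γ : ℝ} (hγ : 0 ≤ γ) {y : ℝ → ℝ × ℝ}
    {p q : ℝ × ℝ} (h : IsHeteroclinicOrbit γ 1 y p q) :
    windingNumber p q * Real.pi < 2 * pruferAngle γ + 2 * Real.pi := by
  obtain ⟨n, hn⟩ := h.source_eq.exists_int_mul_two_pi
  obtain ⟨m, hm⟩ := h.target_eq.exists_int_mul_two_pi
  obtain ⟨φ, hφ, hbot, htop⟩ := h.exists_isPhase
  have hw : windingNumber p q = n - m := by
    rw [← windingNumber_int_mul_two_pi p.1 q.1, hn, hm]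
  rw [hw, Int.cast_sub]
  refine hφ.rotation_lt hγ ?_ ?_
  · convert hbot using 2
    rw [← hn]; ring
  · convert htop using 2
    rw [← hm]; ring

theorem theorem2 :
    ∃ g : ℕ → ℝ, g 0 = 0 ∧ StrictMono g ∧
      -- the odd-indexed terms are exactly the positive zeros of `M'_{-i,1/2}(ir)`
      {r : ℝ | 0 < r ∧ deriv (whittakerM (-Complex.I) (1 / 2)) (Complex.I * r) = 0}
        = {r : ℝ | ∃ j : ℕ, 1 ≤ j ∧ r = g (2 * j - 1)} ∧
      -- the even-indexed terms are exactly the positive zeros of `M_{-i,1/2}(ir)`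
      {r : ℝ | 0 < r ∧ whittakerM (-Complex.I) (1 / 2) (Complex.I * r) = 0}
        = {r : ℝ | ∃ j : ℕ, 1 ≤ j ∧ r = g (2 * j)} ∧
      ∀ (γ : ℝ) (k : ℕ), 1 ≤ k → γ ∈ Set.Ioc (g (k - 1)) (g k) →
        (∃ (y : ℝ → ℝ × ℝ) (p q : ℝ × ℝ),
          IsHeteroclinicOrbit γ 1 y p q ∧ windingNumber p q = (k : ℤ)) ∧
        (∃ (y : ℝ → ℝ × ℝ) (p q : ℝ × ℝ),
          IsHeteroclinicOrbit γ 1 y p q ∧ windingNumber p q = (k : ℤ) + 1) ∧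
        (∀ (y : ℝ → ℝ × ℝ) (p q : ℝ × ℝ),
          IsHeteroclinicOrbit γ 1 y p q → windingNumber p q ≤ (k : ℤ) + 1) := by
  have hπ := Real.pi_pos
  choose g hg using fun k : ℕ => surjective_pruferAngle (k * Real.pi / 2)
  have hg0 : g 0 = 0 := strictMono_pruferAngle.injective (by simp [hg, pruferAngle_zero])
  have hmono : StrictMono g := fun a b hab => by
    rw [← strictMono_pruferAngle.lt_iff_lt, hg, hg]
    have : (a : ℝ) < b := by exact_mod_cast hab
    gcongr
  have hpos : ∀ k, 1 ≤ k → 0 < g k := fun k hk => by rw [← hg0]; exact hmono hk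
  have hApos : ∀ r, 0 < r → 0 < pruferAngle r := fun r hr => by
    rw [← pruferAngle_zero]; exact strictMono_pruferAngle hr
  refine ⟨g, hg0, hmono, ?_, ?_, ?_⟩
  · ext r
    simp only [Set.mem_ofPred_eq]
    constructor
    · rintro ⟨hr, h⟩
      rw [deriv_whittakerM_axis_eq_zero_iff hr, axisSlope_eq_zero_iff hr.le,
        Real.cos_eq_zero_iff] at h
      obtain ⟨n, hn⟩ := h
      have h1 := hApos r hr
      rw [hn] at h1
      have h2 : 0 < (2 * n + 1 : ℤ) := by
        have : (0 : ℝ) < ((2 * n + 1 : ℤ) : ℝ) := by push_cast; nlinarith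
        exact_mod_cast this
      lift n to ℕ using by omega
      refine ⟨n + 1, by omega, strictMono_pruferAngle.injective ?_⟩
      rw [hn, hg, show 2 * (n + 1) - 1 = 2 * n + 1 by omega]
      push_cast
      rfl
    · rintro ⟨j, hj, rfl⟩
      obtain ⟨n, rfl⟩ : ∃ n, j = n + 1 := ⟨j - 1, by omega⟩
      have h0 := hpos (2 * (n + 1) - 1) (by omega)
      refine ⟨h0, ?_⟩
      rw [deriv_whittakerM_axis_eq_zero_iff h0, axisSlope_eq_zero_iff h0.le,
        Real.cos_eq_zero_iff]
      refine ⟨n, ?_⟩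
      rw [hg, show 2 * (n + 1) - 1 = 2 * n + 1 by omega]
      push_cast
      rfl
  · ext r
    simp only [Set.mem_ofPred_eq]
    constructor
    · rintro ⟨hr, h⟩
      rw [whittakerM_axis_eq_zero_iff hr, axisWave_eq_zero_iff hr.le, Real.sin_eq_zero_iff] at h
      obtain ⟨n, hn⟩ := h
      have h1 := hApos r hr
      rw [← hn] at h1
      have h2 : 0 < n := by
        have : (0 : ℝ) < n := pos_of_mul_pos_left h1 hπ.le
        exact_mod_cast this
      lift n to ℕ using h2.le
      refine ⟨n, by omega, strictMono_pruferAngle.injective ?_⟩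
      rw [← hn, hg]
      push_cast
      ring
    · rintro ⟨j, hj, rfl⟩
      have h0 := hpos (2 * j) (by omega)
      refine ⟨h0, ?_⟩
      rw [whittakerM_axis_eq_zero_iff h0, axisWave_eq_zero_iff h0.le, Real.sin_eq_zero_iff]
      refine ⟨j, ?_⟩
      rw [hg]
      push_cast
      ring
  · intro γ k hk hγk
    obtain ⟨n, rfl⟩ : ∃ n, k = n + 1 := ⟨k - 1, by omega⟩
    have hγ : 0 ≤ γ := by
      have := hmono.monotone (Nat.zero_le (n + 1 - 1))
      rw [hg0] at this
      exact this.trans hγk.1.le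
    have hlow := strictMono_pruferAngle hγk.1
    have hup := strictMono_pruferAngle.monotone hγk.2
    rw [hg, Nat.add_sub_cancel] at hlow
    rw [hg] at hup
    push_cast at hup
    refine ⟨exists_isHeteroclinicOrbit hγ _ ?_ ?_, exists_isHeteroclinicOrbit hγ _ ?_ ?_, ?_⟩
    · push_cast; linarith
    · push_cast; linarith
    · push_cast; linarith
    · push_cast; linarith
    · intro y p q h
      have h1 := h.windingNumber_mul_pi_lt hγ
      have h2 : (windingNumber p q : ℝ) < ((n + 1 : ℕ) : ℤ) + 1 + 1 := by
        push_cast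
        refine lt_of_mul_lt_mul_right (h1.trans_le ?_) hπ.le
        linarith
      have h3 : windingNumber p q < ((n + 1 : ℕ) : ℤ) + 1 + 1 := by exact_mod_cast h2
      omega
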